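/- Let $\mathbb{K}$ be a field of characteristic $0$, let $n \ge 0$ and $a > 0$ be integers, and let $R = \mathbb{K}[x_1,\dots,x_n]$ with the standard grading. (1) If $F \in R$ is a $\mathbb{K}$-linear combination of monomials none of which is divisible by $x_i^a$ for any $i$, and $\frac{\partial F}{\partial x_1} + \dots + \frac{\partial F}{\partial x_n} = 0$, then $\deg F \le \frac{n(a-1)}{2}$. (2) Let $I \subset R$ be a homogeneous artinian Gorenstein ideal, that is, $A = R/I$ is a finite-dimensional $\mathbb{K}$-vector space whose socle $\{f \in A : x_i f = 0 \text{ for all } i\}$ is one-dimensional. If $x_i^a \in I$ for every $i$ and $x_1 + \dots + x_n \in I$, then the socle degree $\max\{d : A_d \neq 0\}$ of $I$ is at most $\frac{n(a-1)}{2}$. -/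

import Mathlib

namespace LefschetzGorenstein

open MvPolynomial

attribute [local instance] MvPolynomial.gradedAlgebra

variable {K : Type*} [Field K] {n : ℕ}

/-- The graded piece `A_d` of the algebra `A = K[x_1, …, x_n] / I`: the classes of the forms of
degree `d` (for a homogeneous ideal `I`). -/
noncomputable def gradedPiece (I : Ideal (MvPolynomial (Fin n) K)) (d : ℕ) :
    Submodule K (MvPolynomial (Fin n) K ⧸ I) :=
  (homogeneousSubmodule (Fin n) K d).map (Ideal.Quotient.mkₐ K I).toLinearMap

/-- The socle `{f ∈ A | 𝔪 f = 0}` of the algebra `A = K[x_1, …, x_n] / I`, where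
`𝔪 = (x_1, …, x_n)`. -/
def socle (I : Ideal (MvPolynomial (Fin n) K)) :
    Submodule K (MvPolynomial (Fin n) K ⧸ I) where
  carrier := {f | ∀ g ∈ Ideal.span (Set.range (X : Fin n → MvPolynomial (Fin n) K)),
    Ideal.Quotient.mk I g * f = 0}
  add_mem' hf hf' g hg := by rw [mul_add, hf g hg, hf' g hg, add_zero]
  zero_mem' _ _ := mul_zero _
  smul_mem' c f hf g hg := by rw [mul_smul_comm, hf g hg, smul_zero]

/-- A homogeneous ideal `I` is artinian Gorenstein if the graded algebra `A = K[x_1, …, x_n] / I`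
is a finite dimensional vector space whose socle is one-dimensional. -/
structure IsArtinianGorenstein (I : Ideal (MvPolynomial (Fin n) K)) : Prop where
  isHomogeneous : I.IsHomogeneous (homogeneousSubmodule (Fin n) K)
  finiteDimensional : FiniteDimensional K (MvPolynomial (Fin n) K ⧸ I)
  finrank_socle : Module.finrank K (socle I) = 1

/-- `d` is the socle degree of `I`, that is, `d = max {e | A_e ≠ 0}` for
`A = K[x_1, …, x_n] / I`. -/
def IsSocleDegree (I : Ideal (MvPolynomial (Fin n) K)) (d : ℕ) : Prop :=
  IsGreatest {e : ℕ | gradedPiece I e ≠ ⊥} d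

end LefschetzGorenstein

/-! The monomials with all exponents below `a` span an `sl₂`-representation, the tensor product of
`n` irreducibles of dimension `a`. There `lowering` is `∑ ∂ᵢ`, and degree `d` has weight `n(a-1) -
2d`. A nonzero form killed by `lowering` cannot have negative weight, since `raising` would then
never annihilate it (`eq_zero_of_lowering_eq_zero`). This gives (1). For (2), Macaulay duality turns
a functional on `A` not vanishing on `A_d` into a polynomial of degree `d` as in (1): `xᵢ^a ∈ I`
bounds its exponents and `∑ xᵢ ∈ I` makes `∑ ∂ᵢ` kill it. -/

open MvPolynomial

/-! ### The `sl₂`-action -/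

section LoweringRaising

variable {σ K : Type*} [Field K]

theorem MvPolynomial.pderiv_pderiv_comm {R : Type*} [CommSemiring R] (i j : σ)
    (f : MvPolynomial σ R) : pderiv i (pderiv j f) = pderiv j (pderiv i f) := by
  classical
  rcases eq_or_ne i j with rfl | hij
  · rfl
  ext m
  simp only [coeff_pderiv, Finsupp.add_apply, Finsupp.single_eq_of_ne hij,
    Finsupp.single_eq_of_ne hij.symm, add_right_comm m, add_zero]
  ring

/-- The polynomials all of whose monomials have degree `d` and exponents less than `a`. -/
noncomputable def boundedForms (σ K : Type*) [Field K] (a d : ℕ) :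
    Submodule K (MvPolynomial σ K) :=
  restrictSupport K {m | m.degree = d ∧ ∀ i, m i < a}

theorem mem_boundedForms {a d : ℕ} {f : MvPolynomial σ K} :
    f ∈ boundedForms σ K a d ↔ ∀ m ∈ f.support, m.degree = d ∧ ∀ i, m i < a :=
  Iff.rfl

theorem isHomogeneous_of_mem_boundedForms {a d : ℕ} {f : MvPolynomial σ K}
    (hf : f ∈ boundedForms σ K a d) : f.IsHomogeneous d := by
  rw [← mem_homogeneousSubmodule, homogeneousSubmodule_eq_finsupp_supported]
  exact fun m hm => (mem_boundedForms.1 hf m hm).1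

variable [Fintype σ]

/-- The sum of all partial derivatives. -/
noncomputable def lowering (σ K : Type*) [Field K] [Fintype σ] :
    MvPolynomial σ K →ₗ[K] MvPolynomial σ K :=
  ∑ i, (pderiv i).toLinearMap

theorem lowering_apply (f : MvPolynomial σ K) : lowering σ K f = ∑ i, pderiv i f := by
  simp [lowering]

/-- The operator which, together with `lowering`, makes the span of the monomials with exponents
less than `a` a representation of `sl₂`. -/
noncomputable def raising (σ K : Type*) [Field K] [Fintype σ] (a : ℕ) :
    MvPolynomial σ K →ₗ[K] MvPolynomial σ K :=
  ∑ i, LinearMap.mulLeft K (X i) ∘ₗ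
    (((a : K) - 1) • LinearMap.id - LinearMap.mulLeft K (X i) ∘ₗ (pderiv i).toLinearMap)

theorem raising_apply (a : ℕ) (f : MvPolynomial σ K) :
    raising σ K a f = ∑ i, X i * (((a : K) - 1) • f - X i * pderiv i f) := by
  simp [raising]

theorem raising_mem_boundedForms {a d : ℕ} {f : MvPolynomial σ K}
    (hf : f ∈ boundedForms σ K a d) : raising σ K a f ∈ boundedForms σ K a (d + 1) := by
  classical
  suffices h : boundedForms σ K a d ≤ (boundedForms σ K a (d + 1)).comap (raising σ K a) from h hf
  conv_lhs => rw [boundedForms, restrictSupport_eq_span]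
  rw [Submodule.span_le]
  rintro _ ⟨m, ⟨hd, hm⟩, rfl⟩
  rw [SetLike.mem_coe, Submodule.mem_comap, raising_apply]
  refine Submodule.sum_mem _ fun i _ => ?_
  rw [X_mul_pderiv_monomial, ← Nat.cast_smul_eq_nsmul K, ← sub_smul, mul_smul_comm,
    X, monomial_mul, smul_monomial, boundedForms, monomial_mem_restrictSupport]
  rcases (Nat.succ_le_of_lt (hm i)).eq_or_lt with h | h
  -- At exponent `a - 1` the coefficient `a - 1 - m i` vanishes, so exponent `a` is never reached.
  · right
    rw [← h]
    simp
  · left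
    refine ⟨by rw [map_add, Finsupp.degree_single, hd, add_comm], fun j => ?_⟩
    rcases eq_or_ne j i with rfl | hj
    · simpa [add_comm] using h
    · simpa [Finsupp.single_eq_of_ne hj] using hm j

theorem iterate_raising_mem_boundedForms {a d : ℕ} {f : MvPolynomial σ K}
    (hf : f ∈ boundedForms σ K a d) (k : ℕ) :
    (raising σ K a)^[k] f ∈ boundedForms σ K a (d + k) := by
  induction k with
  | zero => exact hf
  | succ k ih =>
    rw [Function.iterate_succ_apply']
    exact raising_mem_boundedForms ih

theorem eq_zero_of_mem_boundedForms {a d : ℕ} {f : MvPolynomial σ K}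
    (hf : f ∈ boundedForms σ K a d) (hd : Fintype.card σ * a < d) : f = 0 := by
  by_contra h
  obtain ⟨m, hm⟩ := support_nonempty.2 h
  obtain ⟨hmd, hma⟩ := mem_boundedForms.1 hf m hm
  rw [Finsupp.degree_eq_sum] at hmd
  have := Finset.sum_le_card_nsmul Finset.univ m a fun i _ => (hma i).le
  rw [Finset.card_univ, smul_eq_mul, hmd] at this
  exact this.not_gt hd

/-- Terms with `i ≠ j` commute; the correction comes from the diagonal. On forms, Euler's identity
makes it a scalar, the weight. -/
theorem lowering_raising (a : ℕ) (f : MvPolynomial σ K) :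
    lowering σ K (raising σ K a f) = raising σ K a (lowering σ K f) +
      ((Fintype.card σ * ((a : K) - 1)) • f - 2 * ∑ i, X i * pderiv i f) := by
  classical
  have key (i j : σ) : pderiv j (X i * (((a : K) - 1) • f - X i * pderiv i f)) =
      X i * (((a : K) - 1) • pderiv j f - X i * pderiv i (pderiv j f)) +
        if i = j then ((a : K) - 1) • f - 2 * (X i * pderiv i f) else 0 := by
    rw [pderiv_mul, map_sub, pderiv_mul, Derivation.map_smul, pderiv_pderiv_comm i j]
    split_ifs with h
    · subst h
      rw [pderiv_X_self]
      ring
    · rw [pderiv_X_of_ne h]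
      ring
  simp only [lowering_apply, raising_apply, map_sum, key, Finset.sum_add_distrib]
  refine congrArg₂ (· + ·) ?_ ?_
  · exact Finset.sum_comm
  · simp only [Finset.sum_ite_eq, Finset.mem_univ, if_true, Finset.sum_sub_distrib,
      Finset.sum_const, Finset.card_univ, Finset.mul_sum, mul_smul, Nat.cast_smul_eq_nsmul]

theorem lowering_raising_of_isHomogeneous (a : ℕ) {d : ℕ} {f : MvPolynomial σ K}
    (hf : f.IsHomogeneous d) :
    lowering σ K (raising σ K a f) = raising σ K a (lowering σ K f) +
      (Fintype.card σ * ((a : K) - 1) - 2 * d) • f := by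
  rw [lowering_raising, hf.sum_X_mul_pderiv, sub_smul, mul_smul 2, Nat.cast_smul_eq_nsmul,
    two_smul, two_mul]

/-- The scalar is the sum of the weights in degrees `d, …, d + k`. -/
theorem lowering_iterate_raising {a d : ℕ} {f : MvPolynomial σ K}
    (hf : f ∈ boundedForms σ K a d) (h : lowering σ K f = 0) (k : ℕ) :
    lowering σ K ((raising σ K a)^[k + 1] f) =
      ((k + 1) * (Fintype.card σ * ((a : K) - 1) - 2 * d - k)) • (raising σ K a)^[k] f := by
  induction k with
  | zero => simpa [h] using lowering_raising_of_isHomogeneous a (isHomogeneous_of_mem_boundedForms hf)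
  | succ k ih =>
    rw [Function.iterate_succ_apply', lowering_raising_of_isHomogeneous a
      (isHomogeneous_of_mem_boundedForms (iterate_raising_mem_boundedForms hf (k + 1))), ih,
      map_smul, ← Function.iterate_succ_apply' (raising σ K a), ← add_smul]
    congr 1
    push_cast
    ring

/-- The sum of the partial derivatives is injective on `boundedForms σ K a d` above the middle
degree. -/
theorem eq_zero_of_lowering_eq_zero [CharZero K] {a d : ℕ} {f : MvPolynomial σ K}
    (hf : f ∈ boundedForms σ K a d) (h : lowering σ K f = 0)
    (hd : Fintype.card σ * ((a : ℤ) - 1) < 2 * d) : f = 0 := by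
  have step (k : ℕ) (hk : (raising σ K a)^[k + 1] f = 0) : (raising σ K a)^[k] f = 0 := by
    have := lowering_iterate_raising hf h k
    rw [hk, map_zero, eq_comm, smul_eq_zero] at this
    refine this.resolve_left (mul_ne_zero (Nat.cast_add_one_ne_zero k) ?_)
    -- Above the middle degree this factor is negative for every `k`.
    have hne : (Fintype.card σ * ((a : ℤ) - 1) - 2 * d - k) ≠ 0 := by omega
    exact_mod_cast (Int.cast_ne_zero (α := K)).2 hne
  have down (k : ℕ) : (raising σ K a)^[k] f = 0 → f = 0 := by
    induction k with
    | zero => exact id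
    | succ k ih => exact fun hk => ih (step k hk)
  -- So many raisings push the degree past `card σ * a`, where no bounded monomials exist.
  exact down _ (eq_zero_of_mem_boundedForms
    (iterate_raising_mem_boundedForms hf (Fintype.card σ * a + 1)) (by omega))

theorem lowering_homogeneousComponent {d : ℕ} {f : MvPolynomial σ K} (h : lowering σ K f = 0) :
    lowering σ K (homogeneousComponent d f) = 0 := by
  rw [lowering_apply] at h ⊢
  ext m
  have hm := congrArg (coeff m) h
  simp only [coeff_sum, coeff_pderiv, coeff_homogeneousComponent, map_add, Finsupp.degree_single,
    coeff_zero] at hm ⊢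
  split_ifs
  · exact hm
  · simp

end LoweringRaising

theorem X_pow_dvd_monomial_one_iff {σ K : Type*} [Field K] {i : σ} {a : ℕ} {m : σ →₀ ℕ} :
    (X i ^ a : MvPolynomial σ K) ∣ monomial m 1 ↔ a ≤ m i := by
  classical
  rw [X_pow_eq_monomial, monomial_dvd_monomial]
  simp

/-- A polynomial with exponents less than `a` which is annihilated by the sum of the partial
derivatives has degree at most `n (a - 1) / 2`. -/
theorem two_mul_totalDegree_le {σ K : Type*} [Field K] [CharZero K] [Fintype σ] {a : ℕ}
    (ha : 0 < a) {F : MvPolynomial σ K} (hF : ∑ i, pderiv i F = 0)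
    (hm : ∀ m ∈ F.support, ∀ i, m i < a) :
    2 * (F.totalDegree : ℤ) ≤ Fintype.card σ * ((a : ℤ) - 1) := by
  by_contra! hlt
  -- Excludes `F = 0`, whose `totalDegree` is `0` by convention.
  have ha' : (0 : ℤ) ≤ Fintype.card σ * ((a : ℤ) - 1) := mul_nonneg (by positivity) (by omega)
  have hF0 : F ≠ 0 := by
    rintro rfl
    simp at hlt
    omega
  obtain ⟨m, hmF, hmd⟩ := F.support.exists_mem_eq_sup (support_nonempty.2 hF0)
    fun m => m.degree
  replace hmd : F.totalDegree = m.degree := hmd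
  have h0 : homogeneousComponent F.totalDegree F = 0 := by
    refine eq_zero_of_lowering_eq_zero (a := a) (mem_boundedForms.2 fun k hk => ?_)
      (lowering_homogeneousComponent (by rwa [lowering_apply])) hlt
    rw [mem_support_iff, coeff_homogeneousComponent, ite_ne_right_iff] at hk
    exact ⟨hk.1, hm k (mem_support_iff.2 hk.2)⟩
  have := congrArg (coeff m) h0
  rw [coeff_homogeneousComponent, if_pos hmd.symm, coeff_zero] at this
  exact mem_support_iff.1 hmF this

/-! ### Macaulay duality -/

section InverseSystem

variable {K : Type*} [Field K] {n : ℕ}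

/-- The form of degree `d` which corresponds to a linear functional on the polynomials under the
contraction pairing. -/
noncomputable def inverseForm (φ : MvPolynomial (Fin n) K →ₗ[K] K) (d : ℕ) :
    MvPolynomial (Fin n) K :=
  ∑ m ∈ Finset.univ.finsuppAntidiag d,
    monomial m (φ (monomial m 1) / ∏ i, ((m i).factorial : K))

theorem coeff_inverseForm (φ : MvPolynomial (Fin n) K →ₗ[K] K) (d : ℕ) (m : Fin n →₀ ℕ) :
    coeff m (inverseForm φ d) =
      if m.degree = d then φ (monomial m 1) / ∏ i, ((m i).factorial : K) else 0 := by
  simp [inverseForm, coeff_sum, coeff_monomial, Finsupp.degree_eq_sum]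

/-- Dividing by the factorials makes `∂ᵢ` dual to multiplication by `xᵢ`: in degree `d - 1`, the
coefficient at `m` is `φ((∑ xᵢ) x^m) / m!`. -/
theorem sum_pderiv_inverseForm [CharZero K] (φ : MvPolynomial (Fin n) K →ₗ[K] K) (d : ℕ)
    (hφ : ∀ g, φ ((∑ i, X i) * g) = 0) : ∑ i, pderiv i (inverseForm φ d) = 0 := by
  ext m
  have key (i : Fin n) : (∏ j, (((m + Finsupp.single i 1 : Fin n →₀ ℕ) j).factorial : K)) =
      (m i + 1) * ∏ j, ((m j).factorial : K) := by
    rw [← Finset.mul_prod_erase _ _ (Finset.mem_univ i),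
      ← Finset.mul_prod_erase Finset.univ (fun j => ((m j).factorial : K)) (Finset.mem_univ i),
      ← mul_assoc]
    congr 1
    · simp [Nat.factorial_succ]
    · refine Finset.prod_congr rfl fun j hj => ?_
      simp [Finsupp.single_eq_of_ne (Finset.ne_of_mem_erase hj)]
  simp only [coeff_sum, coeff_pderiv, coeff_inverseForm, map_add, Finsupp.degree_single,
    coeff_zero, key]
  split_ifs
  · have h := hφ (monomial m 1)
    rw [Finset.sum_mul, map_sum] at h
    rw [← zero_div (∏ j, ((m j).factorial : K)), ← h, Finset.sum_div]
    refine Finset.sum_congr rfl fun i _ => ?_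
    rw [X, monomial_mul, one_mul, add_comm m]
    have := Nat.cast_add_one_ne_zero (R := K) (m i)
    field_simp
  · simp

end InverseSystem

/-! ### The socle degree bound -/

namespace LefschetzGorenstein

variable {K : Type*} [Field K] {n : ℕ}

theorem gradedPiece_ne_bot_iff {I : Ideal (MvPolynomial (Fin n) K)} {d : ℕ} :
    gradedPiece I d ≠ ⊥ ↔ ∃ m : Fin n →₀ ℕ, m.degree = d ∧ monomial m 1 ∉ I := by
  have h : homogeneousSubmodule (Fin n) K d = restrictSupport K {m | m.degree = d} :=
    homogeneousSubmodule_eq_finsupp_supported (Fin n) K d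
  rw [gradedPiece, ne_eq, ← LinearMap.le_ker_iff_map, h, restrictSupport_eq_span,
    Submodule.span_le, Set.not_subset, Set.exists_mem_image]
  simp [Ideal.Quotient.eq_zero_iff_mem]

theorem two_mul_le_of_gradedPiece_ne_bot [CharZero K] {a : ℕ} (ha : 0 < a)
    {I : Ideal (MvPolynomial (Fin n) K)} (hX : ∀ i, X i ^ a ∈ I) (hl : ∑ i, X i ∈ I) {d : ℕ}
    (hd : gradedPiece I d ≠ ⊥) : 2 * (d : ℤ) ≤ n * ((a : ℤ) - 1) := by
  obtain ⟨m, rfl, hm⟩ := gradedPiece_ne_bot_iff.1 hd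
  have hm' : Ideal.Quotient.mkₐ K I (monomial m 1) ≠ 0 := by
    rwa [Ideal.Quotient.mkₐ_eq_mk, ne_eq, Ideal.Quotient.eq_zero_iff_mem]
  -- A functional nonzero on the class of `x^m` keeps `m` in the support of its inverse form.
  obtain ⟨ψ, hψ⟩ := not_forall.1 (mt (Module.forall_dual_apply_eq_zero_iff K _).1 hm')
  set φ : MvPolynomial (Fin n) K →ₗ[K] K := ψ ∘ₗ (Ideal.Quotient.mkₐ K I).toLinearMap with hφ_def
  have hφ {f : MvPolynomial (Fin n) K} (hf : f ∈ I) : φ f = 0 := by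
    simp [hφ_def, Ideal.Quotient.eq_zero_iff_mem.2 hf]
  have hmF : m ∈ (inverseForm φ m.degree).support := by
    rw [mem_support_iff, coeff_inverseForm, if_pos rfl]
    exact div_ne_zero hψ (Finset.prod_ne_zero_iff.2 fun i _ =>
      Nat.cast_ne_zero.2 (Nat.factorial_ne_zero _))
  have hle : m.degree ≤ (inverseForm φ m.degree).totalDegree := le_totalDegree hmF
  have := two_mul_totalDegree_le ha
    (sum_pderiv_inverseForm φ m.degree fun g => hφ (I.mul_mem_right g hl)) fun k hk i => by
      by_contra! hki
      rw [mem_support_iff, coeff_inverseForm,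
        hφ (I.mem_of_dvd (X_pow_dvd_monomial_one_iff.2 hki) (hX i))] at hk
      simp at hk
  rw [Fintype.card_fin] at this
  omega

theorem IsArtinianGorenstein.ne_top {I : Ideal (MvPolynomial (Fin n) K)}
    (hI : IsArtinianGorenstein I) : I ≠ ⊤ := by
  rintro rfl
  have := hI.finrank_socle
  have : Subsingleton (MvPolynomial (Fin n) K ⧸ (⊤ : Ideal (MvPolynomial (Fin n) K))) :=
    Ideal.Quotient.subsingleton_iff.2 rfl
  rw [Module.finrank_zero_of_subsingleton] at *
  simp_all

end LefschetzGorenstein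

theorem corollaryc {K : Type*} [Field K] [CharZero K] (n a : ℕ) (ha : 0 < a) :
    (∀ F : MvPolynomial (Fin n) K,
      ∑ i, MvPolynomial.pderiv i F = 0 →
      (∀ m ∈ F.support, ∀ i : Fin n,
        ¬ (MvPolynomial.X i ^ a : MvPolynomial (Fin n) K) ∣ MvPolynomial.monomial m 1) →
      (F.totalDegree : ℚ) ≤ (n : ℚ) * ((a : ℚ) - 1) / 2) ∧
    (∀ I : Ideal (MvPolynomial (Fin n) K),
      LefschetzGorenstein.IsArtinianGorenstein I →
      (∀ i : Fin n, (MvPolynomial.X i ^ a : MvPolynomial (Fin n) K) ∈ I) →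
      (∑ i : Fin n, (MvPolynomial.X i : MvPolynomial (Fin n) K)) ∈ I →
      ∃ d : ℕ, LefschetzGorenstein.IsSocleDegree I d ∧
        (d : ℚ) ≤ (n : ℚ) * ((a : ℚ) - 1) / 2) := by
  have cast {d : ℕ} (h : 2 * (d : ℤ) ≤ n * ((a : ℤ) - 1)) :
      (d : ℚ) ≤ (n : ℚ) * ((a : ℚ) - 1) / 2 := by
    rw [le_div_iff₀ two_pos, mul_comm]
    exact_mod_cast h
  refine ⟨fun F hF hm => cast ?_, fun I hI hX hl => ?_⟩
  · simpa using two_mul_totalDegree_le ha hF fun m hmF i =>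
      not_le.1 (mt X_pow_dvd_monomial_one_iff.2 (hm m hmF i))
  · have bound {d : ℕ} := LefschetzGorenstein.two_mul_le_of_gradedPiece_ne_bot (d := d) ha hX hl
    set s : Set ℕ := {e | LefschetzGorenstein.gradedPiece I e ≠ ⊥} with hs
    have hne : s.Nonempty := ⟨0, LefschetzGorenstein.gradedPiece_ne_bot_iff.2
      ⟨0, by simp, fun h => hI.ne_top ((Ideal.eq_top_iff_one I).2 h)⟩⟩
    have hbdd : BddAbove s := ⟨(n * ((a : ℤ) - 1)).toNat, fun e he => by
      have := bound he
      omega⟩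
    exact ⟨sSup s, ⟨Nat.sSup_mem hne hbdd, fun e he => le_csSup hbdd he⟩,
      cast (bound (Nat.sSup_mem hne hbdd))⟩
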